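/- **Setting.** In a linear bandit with arm set $\mathcal X=\{x_1,\dots,x_K\}\subset\mathbb R^d$ and unknown parameter $\theta\in\mathbb R^d$, pulling $x\in\mathcal X$ yields the reward $\langle x,\theta\rangle+\varepsilon$ with independent noise $\varepsilon\sim N(0,1)$. Fix $L>0$. A parameter $\theta$ is *admissible* if the best arm $x^*=\arg\max_{x\in\mathcal X}\langle x,\theta\rangle$ is unique and $|\langle x,\theta\rangle|\le L$ for all $x\in\mathcal X$. Let $\Delta_x=\langle x^*-x,\theta\rangle$, and for $w\in\mathbb R^{\mathcal X}_{\ge 0}$ let $H_w=\sum_{x}w_x\,xx^\top$. Define $$c^*(\theta)=\inf\Big\{\sum_{x}w_x\Delta_x \;:\; w\in\mathbb R_{\ge0}^{\mathcal X},\ H_w\ \text{invertible},\ \|x-x^*\|^2_{H_w^{-1}}\le \tfrac{\Delta_x^2}{2}\ \text{for all } x\ne x^*\Big\}.$$ For each horizon $T$, a *batched algorithm* works as follows: at the beginning of each batch it chooses the (positive) size of the batch and the arms to pull in it, from its internal randomness and the data of the previous batches only; the batch sizes add up to $T$. Thus batch sizes and the number of batches $B_T$ may be random. Let $R_T(\theta)=\mathbb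 E_\theta\big[\sum_{t=1}^T\langle x^*-x_t,\theta\rangle\big]$ be its regret, where $x_t$ is the arm pulled in round $t$. The algorithm (a family indexed by $T$) is *asymptotically optimal* on $\mathcal X$ if $\lim_{T\to\infty}R_T(\theta)/\log T=c^*(\theta)$ for every admissible $\theta$. **Theorem.** Any asymptotically optimal batched algorithm must use at least $3$ batches in expectation as $T\to\infty$ on some instance. More precisely, let $L>0$ and let $\mathcal X=\{(1,0),(0,1)\}\subset\mathbb R^2$. If a batched algorithm is asymptotically optimal on $\mathcal X$, then $$\liminf_{T\to\infty}\mathbb E_\theta[B_T]\ge 3$$ for every admissible $\theta\in\mathbb R^2$ (and admissible parameters exist), in particular for $\theta=(\alpha,0)$ and $\theta=(0,\alpha)$ with $0<\alpha\le L$. -/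

import Mathlib

open MeasureTheory ProbabilityTheory Filter Topology
open scoped ENNReal Matrix

noncomputable section

/-! ### Linear bandit instances -/

/-- Mean reward `⟨x_i, θ⟩` of arm `i`, where `X i` is the feature vector of arm `i`. -/
def meanReward {d : ℕ} {ι : Type*} (X : ι → Fin d → ℝ) (θ : Fin d → ℝ) (i : ι) : ℝ :=
  X i ⬝ᵥ θ

/-- Suboptimality gap `max_x ⟨x, θ⟩ - ⟨x_i, θ⟩` of arm `i` (it is `0` for a best arm). -/
def gap {d : ℕ} {ι : Type*} (X : ι → Fin d → ℝ) (θ : Fin d → ℝ) (i : ι) : ℝ :=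
  (⨆ j, meanReward X θ j) - meanReward X θ i

/-- The instance `(X, θ)` is admissible: its best arm is unique and its expected rewards are
bounded by `L`. -/
def IsAdmissible {d : ℕ} {ι : Type*} (L : ℝ) (X : ι → Fin d → ℝ) (θ : Fin d → ℝ) : Prop :=
  (∃ b, ∀ i, i ≠ b → meanReward X θ i < meanReward X θ b) ∧ ∀ i, |meanReward X θ i| ≤ L

/-- The matrix `H_w = ∑_x w_x x xᵀ` of an allocation `w`. -/
def designMatrix {d : ℕ} {ι : Type*} [Fintype ι] (X : ι → Fin d → ℝ) (w : ι → ℝ) :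
    Matrix (Fin d) (Fin d) ℝ :=
  ∑ i, w i • Matrix.vecMulVec (X i) (X i)

/-- Feasible allocations of the convex program that defines `c*`: `w ≥ 0` and
`‖x - x*‖²_{H_w⁻¹} ≤ Δ_x² / 2` for all `x ≠ x*`. As the constraint speaks of `H_w⁻¹`,
the matrix `H_w` has to be invertible, that is, positive definite. -/
def IsFeasible {d : ℕ} {ι : Type*} [Fintype ι] (X : ι → Fin d → ℝ) (θ : Fin d → ℝ)
    (w : ι → ℝ) : Prop :=
  (∀ i, 0 ≤ w i) ∧ (designMatrix X w).PosDef ∧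
    ∀ b, gap X θ b = 0 → ∀ i, i ≠ b →
      (X i - X b) ⬝ᵥ ((designMatrix X w)⁻¹ *ᵥ (X i - X b)) ≤ gap X θ i ^ 2 / 2

/-- The constant `c*(θ)`: the value of the convex program. -/
def cStar {d : ℕ} {ι : Type*} [Fintype ι] (X : ι → Fin d → ℝ) (θ : Fin d → ℝ) : ℝ :=
  sInf {c | ∃ w : ι → ℝ, IsFeasible X θ w ∧ c = ∑ i, w i * gap X θ i}

/-! ### Batched algorithms -/

/-- A batched algorithm with horizon `T`, arms indexed by `ι`, and internal randomness drawn once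
and for all from `Ω`. If a batch starts after `n` pulls, then its size and the arms pulled in it
are chosen from the seed `ω` and from the rewards of these first `n` pulls. (The arms and the batch
sizes of the past are themselves functions of the seed and of the past rewards, so that the
algorithm knows them as well.) Batches are nonempty and do not exceed the horizon. -/
structure BatchedAlgorithm (Ω ι : Type*) [MeasurableSpace Ω] (T : ℕ) where
  /-- the size of the batch that starts after `n` pulls -/
  size : (n : ℕ) → Ω → (Fin n → ℝ) → ℕ
  /-- the arm in position `j = 0, 1, …` of the batch that starts after `n` pulls -/
  arm : (n : ℕ) → Ω → (Fin n → ℝ) → ℕ → ι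
  size_pos : ∀ n ω h, n < T → 0 < size n ω h
  size_le : ∀ n ω h, n < T → n + size n ω h ≤ T
  measurable_size : ∀ n, Measurable fun p : Ω × (Fin n → ℝ) => size n p.1 p.2
  measurable_arm : ∀ n j i, MeasurableSet {p : Ω × (Fin n → ℝ) | arm n p.1 p.2 j = i}

namespace BatchedAlgorithm

variable {Ω ι : Type*} [MeasurableSpace Ω] {T : ℕ}

/-- The first round of the batch to which round `t` belongs (rounds are numbered `0, 1, …`), when
the seed is `ω` and `r s` is the reward of round `s`. A new batch starts as soon as the current one
is complete. -/
def batchStart (A : BatchedAlgorithm Ω ι T) (ω : Ω) (r : ℕ → ℝ) : ℕ → ℕ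
  | 0 => 0
  | t + 1 =>
    if batchStart A ω r t + A.size (batchStart A ω r t) ω (fun i => r i) ≤ t + 1 then t + 1
    else batchStart A ω r t

/-- The arm pulled in round `t`. -/
def pulledArm (A : BatchedAlgorithm Ω ι T) (ω : Ω) (r : ℕ → ℝ) (t : ℕ) : ι :=
  A.arm (A.batchStart ω r t) ω (fun i => r i) (t - A.batchStart ω r t)

/-- The number of batches: the number of rounds `t < T` in which a batch starts. -/
def numBatches (A : BatchedAlgorithm Ω ι T) (ω : Ω) (r : ℕ → ℝ) : ℕ :=
  ((Finset.range T).filter fun t => A.batchStart ω r t = t).card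

/-- The rewards of the rounds before round `t` (and `0` in the other positions), when arm `i` has
mean reward `m i` and `e s` is the noise of round `s`: each reward is the mean reward of the pulled
arm plus the noise. -/
def rewards (A : BatchedAlgorithm Ω ι T) (m : ι → ℝ) (ω : Ω) (e : ℕ → ℝ) : ℕ → ℕ → ℝ
  | 0 => fun _ => 0
  | t + 1 => Function.update (rewards A m ω e t) t
      (m (A.pulledArm ω (rewards A m ω e t) t) + e t)

end BatchedAlgorithm

/-- The law of the noise: independent standard Gaussian variables. -/
def noiseLaw : Measure (ℕ → ℝ) := Measure.infinitePi fun _ => gaussianReal 0 1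

/-- The regret `R_T = E[∑_{t < T} ⟨x* - x_t, θ⟩]` of a batched algorithm with horizon `T`, whose
seed has law `P`, on the instance `(X, θ)`. -/
def regret {Ω ι : Type*} [MeasurableSpace Ω] {d T : ℕ} (P : Measure Ω) (X : ι → Fin d → ℝ)
    (A : BatchedAlgorithm Ω ι T) (θ : Fin d → ℝ) : ℝ :=
  ∫ p : Ω × (ℕ → ℝ), ∑ t ∈ Finset.range T,
    gap X θ (A.pulledArm p.1 (A.rewards (meanReward X θ) p.1 p.2 T) t) ∂(P.prod noiseLaw)

/-- The expected number of batches on the instance `(X, θ)`. -/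
def expectedBatches {Ω ι : Type*} [MeasurableSpace Ω] {d T : ℕ} (P : Measure Ω)
    (X : ι → Fin d → ℝ) (A : BatchedAlgorithm Ω ι T) (θ : Fin d → ℝ) : ℝ≥0∞ :=
  ∫⁻ p : Ω × (ℕ → ℝ),
    (A.numBatches p.1 (A.rewards (meanReward X θ) p.1 p.2 T) : ℝ≥0∞) ∂(P.prod noiseLaw)

/-- Asymptotic optimality on the arm set `X`: `lim R_T / log T = c*(θ)` for every admissible
parameter `θ`. The algorithm may depend on the horizon `T`. -/
def AsymptoticallyOptimal {Ω ι : Type*} [MeasurableSpace Ω] [Fintype ι] {d : ℕ} (L : ℝ)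
    (P : Measure Ω) (X : ι → Fin d → ℝ) (A : (T : ℕ) → BatchedAlgorithm Ω ι T) : Prop :=
  ∀ θ : Fin d → ℝ, IsAdmissible L X θ →
    Tendsto (fun T : ℕ => regret P X (A T) θ / Real.log T) atTop (𝓝 (cStar X θ))

/-- The arm set `{(1, 0), (0, 1)}`. -/
def twoArms : Fin 2 → Fin 2 → ℝ := ![![1, 0], ![0, 1]]

end

/-! Before the first batch ends no reward is known, so its size and its arms depend on the seed
alone and have the same law for every parameter. The proof shows that this batch must be small, and
then that it is too small to justify a commitment for the rest of the run.

Small: take an instance whose means are `±9/10 * L`. Optimality bounds the expected pulls of the bad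
arm asymptotically by `2 / gap ^ 2 * log T`, and the Lai–Robbins argument gives almost as many pulls
with probability tending to one. Hence markedly more pulls are unlikely, in particular in the first
batch (`tendsto_le_firstCount`). Exchanging the two means bounds the first-batch pulls of both arms
by `7/10 / L ^ 2 * log T`.

Too small: with at most two batches, all arms are determined by the data of the first batch. Let `D`
be the gap of `θ`, and move both means towards each other by slightly more than `D / 2`, which
exchanges the best arm. Since `D ≤ 2 * L`, the first batch separates the two instances by a
divergence below `9/10 * log T`. A run of at most two batches gives at least `T / 2` pulls to some
arm. For the better arm of `θ` this has probability `O(log T / T)` on the modified instance, and a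
divergence below `log T` carries this over to a vanishing probability under `θ`; for the other arm,
optimality under `θ` applies directly. So at most two batches have vanishing probability
(`tendsto_numBatches_le_two`).

The transfer between instances is `law_real_le`: a truncated likelihood ratio, with a moment of
order `q > 1` in place of a concentration inequality. -/

noncomputable section

namespace BatchedAlgorithm

/-! ### Combinatorics of batches, pulls and rewards -/

section Structure

variable {Ω ι : Type*} [MeasurableSpace Ω] {T : ℕ} (A : BatchedAlgorithm Ω ι T)

theorem batchStart_le (ω : Ω) (r : ℕ → ℝ) (t : ℕ) : A.batchStart ω r t ≤ t := by
  induction t with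
  | zero => simp [batchStart]
  | succ t ih =>
    rw [batchStart]
    split_ifs <;> omega

theorem size_congr {ω : Ω} {r r' : ℕ → ℝ} {n : ℕ} (h : ∀ i < n, r i = r' i) :
    A.size n ω (fun i => r i) = A.size n ω (fun i => r' i) := by
  congr 1
  funext i
  exact h i i.2

theorem batchStart_congr {ω : Ω} {r r' : ℕ → ℝ} {t : ℕ} (h : ∀ i < t, r i = r' i) :
    A.batchStart ω r t = A.batchStart ω r' t := by
  induction t with
  | zero => rfl
  | succ t ih =>
    have e := ih fun i hi => h i (by omega)
    have hs : A.size (A.batchStart ω r' t) ω (fun i => r i) =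
        A.size (A.batchStart ω r' t) ω (fun i => r' i) :=
      A.size_congr fun i hi => h i (by have := A.batchStart_le ω r' t; omega)
    rw [batchStart, batchStart, e, hs]

theorem arm_congr {ω : Ω} {r r' : ℕ → ℝ} {n : ℕ} (h : ∀ i < n, r i = r' i) :
    A.arm n ω (fun i => r i) = A.arm n ω (fun i => r' i) := by
  congr 1
  funext i
  exact h i i.2

/-- The arm of round `t` is a function of the rewards of the previous rounds. -/
theorem pulledArm_congr {ω : Ω} {r r' : ℕ → ℝ} {t : ℕ} (h : ∀ i < t, r i = r' i) :
    A.pulledArm ω r t = A.pulledArm ω r' t := by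
  rw [pulledArm, pulledArm, A.batchStart_congr h,
    A.arm_congr fun i hi => h i (by have := A.batchStart_le ω r' t; omega)]

theorem batchStart_eq_of_lt {ω : Ω} {r : ℕ → ℝ} {s t : ℕ} (hs : A.batchStart ω r s = s)
    (hst : s ≤ t) (ht : t < s + A.size s ω (fun i => r i)) : A.batchStart ω r t = s := by
  induction t, hst using Nat.le_induction with
  | base => exact hs
  | succ t hst ih =>
    rw [batchStart, ih (by omega), if_neg (by omega)]

theorem batchStart_add_size {ω : Ω} {r : ℕ → ℝ} {s : ℕ} (hs : A.batchStart ω r s = s)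
    (hpos : 0 < A.size s ω (fun i => r i)) :
    A.batchStart ω r (s + A.size s ω (fun i => r i)) = s + A.size s ω (fun i => r i) := by
  obtain ⟨k, hk⟩ := Nat.exists_eq_succ_of_ne_zero hpos.ne'
  -- The batch has `k + 1` rounds, so `s + k` is its last round and the recursion starts a new batch
  -- right after it.
  have h := A.batchStart_eq_of_lt hs (Nat.le_add_right s k) (by omega)
  rw [hk, Nat.succ_eq_add_one, ← add_assoc, batchStart, h, if_pos (by omega)]

/-- The size of the first batch. -/
def firstSize (ω : Ω) : ℕ := A.size 0 ω fun i => (0 : ℕ → ℝ) i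

theorem size_zero (ω : Ω) (h : Fin 0 → ℝ) : A.size 0 ω h = A.firstSize ω := by
  rw [firstSize]
  congr 1
  exact Subsingleton.elim _ _

theorem batchStart_of_lt_firstSize {ω : Ω} {r : ℕ → ℝ} {t : ℕ} (h : t < A.firstSize ω) :
    A.batchStart ω r t = 0 :=
  A.batchStart_eq_of_lt rfl (Nat.zero_le t) (by rw [size_zero]; omega)

/-- The first batch sees an empty history, and `Fin 0 → ℝ` has only one element. This is why the
first batch carries no information about the parameter. -/
theorem pulledArm_of_lt_firstSize {ω : Ω} (r r' : ℕ → ℝ) {t : ℕ} (h : t < A.firstSize ω) :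
    A.pulledArm ω r t = A.pulledArm ω r' t := by
  rw [pulledArm, pulledArm, A.batchStart_of_lt_firstSize h, A.batchStart_of_lt_firstSize h]
  congr 1
  exact Subsingleton.elim _ _

theorem batchStart_firstSize {ω : Ω} (r : ℕ → ℝ) (hT : 0 < T) :
    A.batchStart ω r (A.firstSize ω) = A.firstSize ω := by
  have h := A.batchStart_add_size (ω := ω) (r := r) (s := 0) rfl (A.size_pos 0 ω _ hT)
  rwa [size_zero, zero_add] at h

/-- If at most two batches are used, then the first one or the second one ends the run. -/
theorem le_of_numBatches_le_two {ω : Ω} {r : ℕ → ℝ} (hT : 0 < T) (h : A.numBatches ω r ≤ 2)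
    (h1 : A.firstSize ω < T) :
    T ≤ A.firstSize ω + A.size (A.firstSize ω) ω (fun i => r i) := by
  by_contra! h2
  have hpos := A.size_pos 0 ω (fun i => (0 : ℕ → ℝ) i) hT
  have hpos' := A.size_pos (A.firstSize ω) ω (fun i => r i) h1
  change 0 < A.firstSize ω at hpos
  have e1 := A.batchStart_firstSize (ω := ω) r hT
  have e2 := A.batchStart_add_size e1 hpos'
  set n := A.firstSize ω
  set k := n + A.size n ω (fun i => r i)
  -- Otherwise three distinct rounds before the horizon start a batch.
  have hsub : ({0, n, k} : Finset ℕ) ⊆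
      (Finset.range T).filter fun t => A.batchStart ω r t = t := by
    intro x hx
    simp only [Finset.mem_insert, Finset.mem_singleton] at hx
    rw [Finset.mem_filter, Finset.mem_range]
    rcases hx with rfl | rfl | rfl
    · exact ⟨hT, rfl⟩
    · exact ⟨h1, e1⟩
    · exact ⟨h2, e2⟩
  have hcard := Finset.card_le_card hsub
  rw [Finset.card_eq_three.2 ⟨0, n, k, by omega, by omega, by omega, rfl⟩] at hcard
  rw [numBatches] at h
  omega

/-- If the second batch ends the run, then all arms are functions of the rewards of the first
batch. -/
theorem pulledArm_congr_of_two_batches {ω : Ω} {r r' : ℕ → ℝ} (hT : 0 < T)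
    (h : T ≤ A.firstSize ω + A.size (A.firstSize ω) ω (fun i => r i))
    (hr : ∀ i < A.firstSize ω, r i = r' i) {t : ℕ} (ht : t < T) :
    A.pulledArm ω r t = A.pulledArm ω r' t := by
  rcases lt_or_ge t (A.firstSize ω) with h1 | h1
  · exact A.pulledArm_of_lt_firstSize r r' h1
  · rw [pulledArm, pulledArm, A.batchStart_eq_of_lt (A.batchStart_firstSize r hT) h1 (by omega),
      A.batchStart_eq_of_lt (A.batchStart_firstSize r' hT) h1
        (by rw [← A.size_congr hr]; omega), A.arm_congr hr]

/-- The number of pulls of arm `i` before round `t`. -/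
def pullCount [DecidableEq ι] (ω : Ω) (r : ℕ → ℝ) (t : ℕ) (i : ι) : ℕ :=
  ((Finset.range t).filter fun s => A.pulledArm ω r s = i).card

/-- The number of pulls of arm `i` in the first batch. -/
def firstCount [DecidableEq ι] (ω : Ω) (i : ι) : ℕ := A.pullCount ω 0 (A.firstSize ω) i

theorem pullCount_congr [DecidableEq ι] {ω : Ω} {r r' : ℕ → ℝ} {t : ℕ}
    (h : ∀ s < t, A.pulledArm ω r s = A.pulledArm ω r' s) (i : ι) :
    A.pullCount ω r t i = A.pullCount ω r' t i := by
  rw [pullCount, pullCount]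
  congr 1
  refine Finset.filter_congr fun s hs => ?_
  rw [h s (Finset.mem_range.1 hs)]

theorem pullCount_mono [DecidableEq ι] (ω : Ω) (r : ℕ → ℝ) {s t : ℕ} (h : s ≤ t) (i : ι) :
    A.pullCount ω r s i ≤ A.pullCount ω r t i :=
  Finset.card_le_card (Finset.filter_subset_filter _ (Finset.range_subset_range.2 h))

theorem pullCount_le [DecidableEq ι] (ω : Ω) (r : ℕ → ℝ) (t : ℕ) (i : ι) :
    A.pullCount ω r t i ≤ t :=
  (Finset.card_filter_le _ _).trans (Finset.card_range t).le

/-- The zero rewards in `firstCount` are a placeholder, as the arms of the first batch ignore all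
rewards. -/
theorem pullCount_firstSize [DecidableEq ι] (ω : Ω) (r : ℕ → ℝ) (i : ι) :
    A.pullCount ω r (A.firstSize ω) i = A.firstCount ω i :=
  A.pullCount_congr (fun _ hs => A.pulledArm_of_lt_firstSize r 0 hs) i

theorem firstSize_le (ω : Ω) (hT : 0 < T) : A.firstSize ω ≤ T := by
  have h := A.size_le 0 ω (fun i => (0 : ℕ → ℝ) i) hT
  rwa [zero_add] at h

theorem firstCount_le_pullCount [DecidableEq ι] (ω : Ω) (r : ℕ → ℝ) (hT : 0 < T) (i : ι) :
    A.firstCount ω i ≤ A.pullCount ω r T i := by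
  rw [← A.pullCount_firstSize ω r]
  exact A.pullCount_mono ω r (A.firstSize_le ω hT) i

/-- Grouping rounds by arm turns the regret, the divergence and the number of rounds into
expressions in the pull counts. -/
theorem sum_pulledArm [DecidableEq ι] [Fintype ι] (f : ι → ℝ) (ω : Ω) (r : ℕ → ℝ) (t : ℕ) :
    ∑ s ∈ Finset.range t, f (A.pulledArm ω r s) = ∑ i, A.pullCount ω r t i * f i := by
  rw [← Finset.sum_fiberwise (Finset.range t) (fun s => A.pulledArm ω r s)]
  refine Finset.sum_congr rfl fun i _ => ?_
  rw [pullCount, ← nsmul_eq_mul]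
  refine Finset.sum_eq_card_nsmul fun s hs => ?_
  rw [(Finset.mem_filter.1 hs).2]

theorem sum_pullCount [DecidableEq ι] [Fintype ι] (ω : Ω) (r : ℕ → ℝ) (t : ℕ) :
    ∑ i, (A.pullCount ω r t i : ℝ) = t := by
  have h := A.sum_pulledArm (fun _ => 1) ω r t
  simpa using h.symm

theorem rewards_congr (m : ι → ℝ) (ω : Ω) {e e' : ℕ → ℝ} {t : ℕ} (h : ∀ i < t, e i = e' i) :
    A.rewards m ω e t = A.rewards m ω e' t := by
  induction t with
  | zero => rfl
  | succ t ih => rw [rewards, rewards, ih fun i hi => h i (by omega), h t (by omega)]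

theorem rewards_update (m : ι → ℝ) (ω : Ω) (e : ℕ → ℝ) (t : ℕ) (x : ℝ) :
    A.rewards m ω (Function.update e t x) (t + 1) =
      Function.update (A.rewards m ω e t) t (m (A.pulledArm ω (A.rewards m ω e t) t) + x) := by
  have h : A.rewards m ω (Function.update e t x) t = A.rewards m ω e t :=
    A.rewards_congr m ω fun i hi => Function.update_of_ne hi.ne _ _
  rw [rewards, h, Function.update_self]

theorem rewards_apply_of_lt (m : ι → ℝ) (ω : Ω) (e : ℕ → ℝ) {s t : ℕ} (hst : s ≤ t) {i : ℕ}
    (hi : i < s) : A.rewards m ω e t i = A.rewards m ω e s i := by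
  induction t, hst using Nat.le_induction with
  | base => rfl
  | succ t hst ih => rw [rewards, Function.update_of_ne (by omega), ih]

end Structure

/-! ### Measurability of the run -/

section Measurability

variable {Ω ι : Type*} [MeasurableSpace Ω] {T : ℕ} (A : BatchedAlgorithm Ω ι T)

/-- The start of a batch is random but takes countably many values, so measurability for each fixed
start suffices. -/
theorem measurable_size_comp {β : Type*} [MeasurableSpace β] {τ : β → ℕ} {f : β → Ω}
    {r : β → ℕ → ℝ} (hτ : Measurable τ) (hf : Measurable f) (hr : Measurable r) :
    Measurable fun b => A.size (τ b) (f b) (fun i => r b i) := by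
  have h : Measurable fun p : ℕ × (Ω × (ℕ → ℝ)) => A.size p.1 p.2.1 (fun i => p.2.2 i) := by
    refine measurable_from_prod_countable_right fun n => ?_
    refine (A.measurable_size n).comp
      (f := fun p : Ω × (ℕ → ℝ) => (p.1, fun i : Fin n => p.2 i)) ?_
    fun_prop
  exact h.comp (hτ.prodMk (hf.prodMk hr))

theorem measurable_batchStart (t : ℕ) :
    Measurable fun p : Ω × (ℕ → ℝ) => A.batchStart p.1 p.2 t := by
  induction t with
  | zero => exact measurable_const
  | succ t ih =>
    simp only [batchStart]
    exact Measurable.ite (measurableSet_le (ih.add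
      (A.measurable_size_comp ih measurable_fst measurable_snd)) measurable_const)
      measurable_const ih

theorem measurable_pulledArm [Countable ι] [MeasurableSpace ι] (t : ℕ) :
    Measurable fun p : Ω × (ℕ → ℝ) => A.pulledArm p.1 p.2 t := by
  refine measurable_to_countable' fun i => ?_
  have h : (fun p : Ω × (ℕ → ℝ) => A.pulledArm p.1 p.2 t) ⁻¹' {i} =
      ⋃ n, {p | A.batchStart p.1 p.2 t = n} ∩
        {p | A.arm n p.1 (fun i => p.2 i) (t - n) = i} := by
    ext p
    simp [pulledArm]
  rw [h]
  refine MeasurableSet.iUnion fun n => ?_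
  refine (A.measurable_batchStart t (measurableSet_singleton n)).inter ?_
  have hm : Measurable fun p : Ω × (ℕ → ℝ) => (p.1, fun i : Fin n => p.2 i) := by fun_prop
  exact hm (A.measurable_arm n (t - n) i)

theorem measurable_rewards [Countable ι] (m : ι → ℝ) (t : ℕ) :
    Measurable fun p : Ω × (ℕ → ℝ) => A.rewards m p.1 p.2 t := by
  let _ : MeasurableSpace ι := ⊤
  induction t with
  | zero => exact measurable_const
  | succ t ih =>
    simp only [rewards]
    have hm : Measurable m := measurable_from_top
    have h1 : Measurable fun p : Ω × (ℕ → ℝ) =>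
        m (A.pulledArm p.1 (A.rewards m p.1 p.2 t) t) + p.2 t :=
      (hm.comp ((A.measurable_pulledArm t).comp (measurable_fst.prodMk ih))).add
        ((measurable_pi_apply t).comp measurable_snd)
    exact measurable_update'.comp (ih.prodMk h1)

theorem measurable_pullCount [DecidableEq ι] [Countable ι] (t : ℕ) (i : ι) :
    Measurable fun p : Ω × (ℕ → ℝ) => A.pullCount p.1 p.2 t i := by
  let _ : MeasurableSpace ι := ⊤
  simp only [pullCount, Finset.card_filter]
  refine Finset.measurable_fun_sum _ fun s _ => ?_
  exact Measurable.ite (A.measurable_pulledArm s (MeasurableSpace.measurableSet_top (s := {i})))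
    measurable_const measurable_const

theorem measurable_numBatches :
    Measurable fun p : Ω × (ℕ → ℝ) => A.numBatches p.1 p.2 := by
  simp only [numBatches, Finset.card_filter]
  refine Finset.measurable_fun_sum _ fun s _ => ?_
  exact Measurable.ite (A.measurable_batchStart s (measurableSet_singleton s))
    measurable_const measurable_const

theorem measurable_firstSize : Measurable A.firstSize :=
  A.measurable_size_comp (τ := fun _ => 0) measurable_const measurable_id
    (measurable_const (a := (0 : ℕ → ℝ)))

theorem measurable_firstCount [DecidableEq ι] [Countable ι] (i : ι) :
    Measurable fun ω => A.firstCount ω i := by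
  have h : Measurable fun p : ℕ × Ω => A.pullCount p.2 0 p.1 i :=
    measurable_from_prod_countable_right fun n =>
      (A.measurable_pullCount n i).comp (measurable_id.prodMk measurable_const)
  exact h.comp (A.measurable_firstSize.prodMk measurable_id)

end Measurability

end BatchedAlgorithm

/-! ### Gaussian noise: resampling and shifts -/

section Noise

instance isProbabilityMeasure_noiseLaw : IsProbabilityMeasure noiseLaw := by
  rw [noiseLaw]
  infer_instance

/-- Resampling one coordinate does not change the law of the noise. -/
theorem noiseLaw_map_update (t : ℕ) :
    (noiseLaw.prod (gaussianReal 0 1)).map (fun p => Function.update p.1 t p.2) = noiseLaw := by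
  refine Measure.eq_infinitePi _ fun s B hB => ?_
  have hmeas : Measurable fun p : (ℕ → ℝ) × ℝ => Function.update p.1 t p.2 := measurable_update'
  rw [Measure.map_apply hmeas (MeasurableSet.pi s.countable_toSet fun i _ => hB i)]
  have hpre : (fun p : (ℕ → ℝ) × ℝ => Function.update p.1 t p.2) ⁻¹' Set.pi s B =
      (Set.pi (s.erase t : Finset ℕ) B) ×ˢ (if t ∈ s then B t else Set.univ) := by
    ext ⟨e, x⟩
    simp only [Set.mem_preimage, Set.mem_pi, Finset.mem_coe, Set.mem_prod, Finset.mem_erase]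
    constructor
    · intro h
      refine ⟨fun i hi => ?_, ?_⟩
      · simpa [Function.update_of_ne hi.1] using h i hi.2
      · split_ifs with ht
        · simpa using h t ht
        · trivial
    · rintro ⟨h1, h2⟩ i hi
      by_cases hit : i = t
      · subst hit
        simpa [hi] using h2
      · simpa [Function.update_of_ne hit] using h1 i ⟨hit, hi⟩
  rw [hpre, Measure.prod_prod, noiseLaw, Measure.infinitePi_pi _ fun i _ => hB i]
  split_ifs with ht
  · exact Finset.prod_erase_mul s (fun i => gaussianReal 0 1 (B i)) ht
  · rw [Finset.erase_eq_of_notMem ht, measure_univ, mul_one]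

/-- Isolates the noise of one round as an inner Gaussian integral, for the induction on rounds in
the change of measure. -/
theorem lintegral_noiseLaw_update (t : ℕ) {K : (ℕ → ℝ) → ℝ≥0∞} (hK : Measurable K) :
    ∫⁻ e, K e ∂noiseLaw =
      ∫⁻ e, ∫⁻ x, K (Function.update e t x) ∂gaussianReal 0 1 ∂noiseLaw := by
  have hmeas : Measurable fun p : (ℕ → ℝ) × ℝ => Function.update p.1 t p.2 := measurable_update'
  conv_lhs => rw [← noiseLaw_map_update t]
  rw [lintegral_map hK hmeas]
  exact lintegral_prod _ (hK.comp hmeas).aemeasurable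

/-- A shift of a standard Gaussian variable as a change of measure. -/
theorem lintegral_gaussianReal_shift (a b : ℝ) {f : ℝ → ℝ≥0∞} (hf : Measurable f) :
    ∫⁻ x, f (a + x) ∂gaussianReal 0 1 =
      ∫⁻ x, f (b + x) * ENNReal.ofReal (Real.exp ((a - b) * x - (a - b) ^ 2 / 2))
        ∂gaussianReal 0 1 := by
  have h1 : ∀ c : ℝ, ∀ g : ℝ → ℝ≥0∞, Measurable g → ∫⁻ x, g (c + x) ∂gaussianReal 0 1 =
      ∫⁻ x, gaussianPDF c 1 x * g x := by
    intro c g hg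
    rw [← lintegral_map hg (measurable_const_add c), gaussianReal_map_const_add, zero_add,
      gaussianReal_of_var_ne_zero _ one_ne_zero,
      lintegral_withDensity_eq_lintegral_mul _ (measurable_gaussianPDF _ _) hg]
    rfl
  have h2 := h1 b (fun y => f y * ENNReal.ofReal
    (Real.exp ((a - b) * (y - b) - (a - b) ^ 2 / 2))) (by fun_prop)
  simp only [add_sub_cancel_left] at h2
  rw [h1 a f hf, h2]
  refine lintegral_congr fun x => ?_
  have h3 : gaussianPDF a 1 x = gaussianPDF b 1 x *
      ENNReal.ofReal (Real.exp ((a - b) * (x - b) - (a - b) ^ 2 / 2)) := by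
    rw [gaussianPDF, gaussianPDF, ← ENNReal.ofReal_mul (gaussianPDFReal_nonneg _ _ _),
      gaussianPDFReal, gaussianPDFReal, mul_assoc (√(2 * Real.pi * ((1 : NNReal) : ℝ)))⁻¹,
      ← Real.exp_add]
    congr 3
    simp only [NNReal.coe_one]
    ring
  rw [h3]
  ring

end Noise

namespace BatchedAlgorithm

/-! ### Change of measure between instances -/

section ChangeOfMeasure

variable {Ω ι : Type*} [MeasurableSpace Ω] {T : ℕ} (A : BatchedAlgorithm Ω ι T)

/-- The log-likelihood ratio between the mean rewards `m` and `m'` of the first `t` rewards. -/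
def logLikelihood (m m' : ι → ℝ) (ω : Ω) (t : ℕ) (r : ℕ → ℝ) : ℝ :=
  ∑ s ∈ Finset.range t, ((m (A.pulledArm ω r s) - m' (A.pulledArm ω r s)) *
    (r s - m' (A.pulledArm ω r s)) - (m (A.pulledArm ω r s) - m' (A.pulledArm ω r s)) ^ 2 / 2)

/-- The sum of the Kullback–Leibler divergences of the first `t` rewards. -/
def divergence (m m' : ι → ℝ) (ω : Ω) (t : ℕ) (r : ℕ → ℝ) : ℝ :=
  ∑ s ∈ Finset.range t, (m (A.pulledArm ω r s) - m' (A.pulledArm ω r s)) ^ 2 / 2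

theorem measurable_mean_pulledArm [Countable ι] (m : ι → ℝ) (ω : Ω) (t : ℕ) :
    Measurable fun r => m (A.pulledArm ω r t) := by
  let _ : MeasurableSpace ι := ⊤
  have hm : Measurable m := measurable_from_top
  exact hm.comp ((A.measurable_pulledArm t).comp measurable_prodMk_left)

theorem measurable_rewards_right [Countable ι] (m : ι → ℝ) (ω : Ω) (t : ℕ) :
    Measurable fun e => A.rewards m ω e t :=
  (A.measurable_rewards m t).comp measurable_prodMk_left

theorem measurable_logLikelihood [Countable ι] (m m' : ι → ℝ) (ω : Ω) (t : ℕ) :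
    Measurable (A.logLikelihood m m' ω t) := by
  refine Finset.measurable_fun_sum _ fun s _ => ?_
  have h1 := A.measurable_mean_pulledArm m ω s
  have h2 := A.measurable_mean_pulledArm m' ω s
  exact ((h1.sub h2).mul ((measurable_pi_apply s).sub h2)).sub
    (((h1.sub h2).pow_const 2).div_const 2)

theorem logLikelihood_update (m m' : ι → ℝ) (ω : Ω) (t : ℕ) (r : ℕ → ℝ) (x : ℝ) :
    A.logLikelihood m m' ω (t + 1) (Function.update r t (m' (A.pulledArm ω r t) + x)) =
      A.logLikelihood m m' ω t r + ((m (A.pulledArm ω r t) - m' (A.pulledArm ω r t)) * x -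
        (m (A.pulledArm ω r t) - m' (A.pulledArm ω r t)) ^ 2 / 2) := by
  have harm : ∀ s ≤ t, ∀ y, A.pulledArm ω (Function.update r t y) s = A.pulledArm ω r s :=
    fun s hs y => A.pulledArm_congr fun i hi => Function.update_of_ne (by omega) _ _
  rw [logLikelihood, logLikelihood, Finset.sum_range_succ]
  congr 1
  · refine Finset.sum_congr rfl fun s hs => ?_
    have hs := Finset.mem_range.1 hs
    rw [harm s hs.le, Function.update_of_ne hs.ne]
  · rw [harm t le_rfl, Function.update_self, add_sub_cancel_left]

/-- Change of measure between two vectors of mean rewards, for a fixed seed. -/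
theorem lintegral_rewards [Countable ι] (m m' : ι → ℝ) (ω : Ω) (t : ℕ) {F : (ℕ → ℝ) → ℝ≥0∞}
    (hF : Measurable F) :
    ∫⁻ e, F (A.rewards m ω e t) ∂noiseLaw =
      ∫⁻ e, F (A.rewards m' ω e t) * ENNReal.ofReal
        (Real.exp (A.logLikelihood m m' ω t (A.rewards m' ω e t))) ∂noiseLaw := by
  induction t generalizing F with
  | zero => simp [rewards, logLikelihood]
  | succ t ih =>
    have hupd : Measurable fun p : (ℕ → ℝ) × ℝ => Function.update p.1 t p.2 := measurable_update'
    have hstep : Measurable fun p : (ℕ → ℝ) × ℝ =>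
        Function.update p.1 t (m (A.pulledArm ω p.1 t) + p.2) :=
      hupd.comp (measurable_fst.prodMk
        (((A.measurable_mean_pulledArm m ω t).comp measurable_fst).add measurable_snd))
    have hF1 : Measurable fun r => ∫⁻ x, F (Function.update r t (m (A.pulledArm ω r t) + x))
        ∂gaussianReal 0 1 := (hF.comp hstep).lintegral_prod_right'
    -- On both sides the noise of round `t` is integrated innermost. The earlier rewards do not
    -- depend on it, so the induction hypothesis treats them and a Gaussian shift treats round `t`.
    refine (lintegral_noiseLaw_update t
      (hF.comp (A.measurable_rewards_right m ω (t + 1)))).trans ?_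
    refine Eq.trans ?_ (lintegral_noiseLaw_update t
      ((hF.comp (A.measurable_rewards_right m' ω (t + 1))).mul
        (((A.measurable_logLikelihood m m' ω (t + 1)).comp
          (A.measurable_rewards_right m' ω (t + 1))).exp.ennreal_ofReal))).symm
    simp only [Function.comp_apply, Pi.mul_apply, A.rewards_update, logLikelihood_update]
    rw [ih hF1]
    refine lintegral_congr fun e => ?_
    set r := A.rewards m' ω e t
    rw [lintegral_gaussianReal_shift (m (A.pulledArm ω r t)) (m' (A.pulledArm ω r t))
        (f := fun y => F (Function.update r t y)) (hF.comp (measurable_update r)),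
      ← lintegral_mul_const]
    · refine lintegral_congr fun x => ?_
      rw [Real.exp_add, ENNReal.ofReal_mul (Real.exp_pos _).le]
      ring
    · have h3 : Measurable fun x =>
          F (Function.update r t (m' (A.pulledArm ω r t) + x)) :=
        hF.comp ((measurable_update r).comp (measurable_const_add _))
      exact h3.mul (by fun_prop)

/-- A power of the likelihood ratio is, up to the divergence, another likelihood ratio. -/
theorem mul_logLikelihood (m m' : ι → ℝ) (ω : Ω) (t : ℕ) (r : ℕ → ℝ) (q : ℝ) :
    q * A.logLikelihood m m' ω t r =
      A.logLikelihood (fun i => m' i + q * (m i - m' i)) m' ω t r +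
        q * (q - 1) * A.divergence m m' ω t r := by
  rw [logLikelihood, logLikelihood, divergence, Finset.mul_sum, Finset.mul_sum,
    ← Finset.sum_add_distrib]
  refine Finset.sum_congr rfl fun s _ => ?_
  ring

/-- Truncation at level `z`: if `x` exceeds `z`, then adding `(q - 1) * (x - z) ≥ 0` to the exponent
only helps. With `x` a log-likelihood ratio, the last term is a moment of order `q`. -/
theorem exp_le_exp_add_exp (x z q : ℝ) (hq : 1 ≤ q) :
    Real.exp x ≤ Real.exp z + Real.exp (q * x - (q - 1) * z) := by
  rcases le_total x z with h | h
  · exact (Real.exp_le_exp.2 h).trans (le_add_of_nonneg_right (Real.exp_pos _).le)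
  · exact (Real.exp_le_exp.2 (by nlinarith)).trans (le_add_of_nonneg_left (Real.exp_pos _).le)

/-- If the divergence is at most `c` on an event, then its probabilities under two vectors of mean
rewards are comparable, up to a factor that is little more than `exp c`. -/
theorem noiseLaw_rewards_le [Countable ι] (m m' : ι → ℝ) (ω : Ω) (t : ℕ) {G : Set (ℕ → ℝ)}
    (hG : MeasurableSet G) {c z q : ℝ} (hq : 1 ≤ q)
    (hc : ∀ r ∈ G, A.divergence m m' ω t r ≤ c) :
    noiseLaw {e | A.rewards m ω e t ∈ G} ≤
      ENNReal.ofReal (Real.exp z) * noiseLaw {e | A.rewards m' ω e t ∈ G} +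
        ENNReal.ofReal (Real.exp ((q - 1) * (q * c - z))) := by
  have hind : ∀ μ : ι → ℝ, noiseLaw {e | A.rewards μ ω e t ∈ G} =
      ∫⁻ e, G.indicator 1 (A.rewards μ ω e t) ∂noiseLaw := by
    intro μ
    exact (lintegral_indicator_one (A.measurable_rewards_right μ ω t hG)).symm
  set mq : ι → ℝ := fun i => m' i + q * (m i - m' i) with hmq
  -- On `G`, the ratio is truncated at `exp z`, and the power `q` of the remainder is rewritten as
  -- the likelihood ratio of the tilted means `mq` times a factor controlled by `c`.
  have hpt : ∀ r, G.indicator (1 : (ℕ → ℝ) → ℝ≥0∞) r *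
      ENNReal.ofReal (Real.exp (A.logLikelihood m m' ω t r)) ≤
      ENNReal.ofReal (Real.exp z) * G.indicator 1 r +
        ENNReal.ofReal (Real.exp ((q - 1) * (q * c - z))) *
          (1 * ENNReal.ofReal (Real.exp (A.logLikelihood mq m' ω t r))) := by
    intro r
    by_cases hr : r ∈ G
    · simp only [Set.indicator_of_mem hr, Pi.one_apply, one_mul, mul_one]
      rw [← ENNReal.ofReal_mul (Real.exp_pos _).le, ← ENNReal.ofReal_add (Real.exp_pos _).le
        (by positivity), ← Real.exp_add]
      refine ENNReal.ofReal_le_ofReal ((exp_le_exp_add_exp _ z q hq).trans ?_)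
      gcongr
      rw [A.mul_logLikelihood, ← hmq]
      have := mul_le_mul_of_nonneg_left (hc r hr)
        (mul_nonneg (zero_le_one.trans hq) (sub_nonneg.2 hq))
      linarith
    · simp [Set.indicator_of_notMem hr]
  rw [hind m, A.lintegral_rewards m m' ω t (measurable_one.indicator hG)]
  refine (lintegral_mono fun e => hpt (A.rewards m' ω e t)).trans ?_
  have hmeas : Measurable fun e => ENNReal.ofReal (Real.exp z) *
      G.indicator (1 : (ℕ → ℝ) → ℝ≥0∞) (A.rewards m' ω e t) :=
    ((measurable_one.indicator hG).comp (A.measurable_rewards_right m' ω t)).const_mul _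
  -- The likelihood ratio of `mq` against `m'` integrates to one.
  rw [lintegral_add_left hmeas, lintegral_const_mul' _ _ ENNReal.ofReal_ne_top,
    lintegral_const_mul' _ _ ENNReal.ofReal_ne_top, ← hind m',
    ← A.lintegral_rewards mq m' ω t (F := fun _ => 1) measurable_const]
  simp

/-- The joint law of the seed and the rewards. -/
def law (P : Measure Ω) (m : ι → ℝ) : Measure (Ω × (ℕ → ℝ)) :=
  (P.prod noiseLaw).map fun p => (p.1, A.rewards m p.1 p.2 T)

variable (P : Measure Ω)

theorem measurable_prodMk_rewards [Countable ι] (m : ι → ℝ) :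
    Measurable fun p : Ω × (ℕ → ℝ) => (p.1, A.rewards m p.1 p.2 T) :=
  measurable_fst.prodMk (A.measurable_rewards m T)

instance isProbabilityMeasure_law [IsProbabilityMeasure P] [Countable ι] (m : ι → ℝ) :
    IsProbabilityMeasure (A.law P m) :=
  Measure.isProbabilityMeasure_map (A.measurable_prodMk_rewards m).aemeasurable

theorem law_preimage_fst [Countable ι] (m : ι → ℝ) {S : Set Ω} (hS : MeasurableSet S) :
    A.law P m (Prod.fst ⁻¹' S) = P S := by
  rw [law, Measure.map_apply (A.measurable_prodMk_rewards m) (measurable_fst hS)]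
  have h : (fun p : Ω × (ℕ → ℝ) => (p.1, A.rewards m p.1 p.2 T)) ⁻¹' (Prod.fst ⁻¹' S) =
      S ×ˢ Set.univ := by
    ext p
    simp
  rw [h, Measure.prod_prod, measure_univ, mul_one]

theorem law_apply [Countable ι] (m : ι → ℝ) {G : Set (Ω × (ℕ → ℝ))} (hG : MeasurableSet G) :
    A.law P m G = ∫⁻ ω, noiseLaw {e | (ω, A.rewards m ω e T) ∈ G} ∂P := by
  rw [law, Measure.map_apply (A.measurable_prodMk_rewards m) hG,
    Measure.prod_apply (A.measurable_prodMk_rewards m hG)]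
  rfl

/-- Change of measure for an event that is determined by the seed and by the rewards of the first
`τ ω` rounds. -/
theorem law_real_le [IsProbabilityMeasure P] [Countable ι] (m m' : ι → ℝ)
    {G : Set (Ω × (ℕ → ℝ))} (hG : MeasurableSet G)
    (τ : Ω → ℕ) (hτ : ∀ ω, τ ω ≤ T)
    (hdet : ∀ ω r r', (∀ i < τ ω, r i = r' i) → (ω, r) ∈ G → (ω, r') ∈ G) {c z q : ℝ}
    (hq : 1 ≤ q) (hc : ∀ ω r, (ω, r) ∈ G → A.divergence m m' ω (τ ω) r ≤ c) :
    (A.law P m).real G ≤ Real.exp z * (A.law P m').real G +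
      Real.exp ((q - 1) * (q * c - z)) := by
  -- For a fixed seed `τ ω` is a constant, so the change of measure may stop there instead of at the
  -- horizon.
  have hset : ∀ (μ : ι → ℝ) ω, {e | (ω, A.rewards μ ω e T) ∈ G} =
      {e | A.rewards μ ω e (τ ω) ∈ Prod.mk ω ⁻¹' G} := by
    intro μ ω
    ext e
    have h : ∀ i < τ ω, A.rewards μ ω e T i = A.rewards μ ω e (τ ω) i :=
      fun i hi => A.rewards_apply_of_lt μ ω e (hτ ω) hi
    exact ⟨hdet _ _ _ h, hdet _ _ _ fun i hi => (h i hi).symm⟩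
  have hle : A.law P m G ≤ ENNReal.ofReal (Real.exp z) * A.law P m' G +
      ENNReal.ofReal (Real.exp ((q - 1) * (q * c - z))) := by
    rw [A.law_apply P m hG, A.law_apply P m' hG,
      ← lintegral_const_mul' _ _ ENNReal.ofReal_ne_top]
    calc _ ≤ ∫⁻ ω, (ENNReal.ofReal (Real.exp z) *
          noiseLaw {e | (ω, A.rewards m' ω e T) ∈ G} +
          ENNReal.ofReal (Real.exp ((q - 1) * (q * c - z)))) ∂P := by
          refine lintegral_mono fun ω => ?_
          rw [hset m ω, hset m' ω]
          exact A.noiseLaw_rewards_le m m' ω (τ ω) (measurable_prodMk_left hG) hq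
            fun r hr => hc ω r hr
      _ = _ := by
          rw [lintegral_add_right _ measurable_const, lintegral_const, measure_univ, mul_one]
  rw [Measure.real, Measure.real]
  refine (ENNReal.toReal_mono (by finiteness) hle).trans_eq ?_
  rw [ENNReal.toReal_add (by finiteness) (by finiteness), ENNReal.toReal_mul,
    ENNReal.toReal_ofReal (Real.exp_pos _).le, ENNReal.toReal_ofReal (Real.exp_pos _).le]

end ChangeOfMeasure

end BatchedAlgorithm

/-! ### The two-armed instance -/

section TwoArms

theorem sum_eq_add_of_ne {a b : Fin 2} (hab : a ≠ b) (f : Fin 2 → ℝ) : ∑ i, f i = f a + f b := by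
  rw [Fin.sum_univ_two]
  fin_cases a <;> fin_cases b <;> first | exact absurd rfl hab | simp [add_comm]

theorem eq_or_eq_of_ne {a b : Fin 2} (hab : a ≠ b) (i : Fin 2) : i = a ∨ i = b := by
  fin_cases a <;> fin_cases b <;> fin_cases i <;> simp_all

theorem meanReward_twoArms (θ : Fin 2 → ℝ) : meanReward twoArms θ = θ := by
  funext i
  fin_cases i <;> simp [meanReward, twoArms, Matrix.vecHead, Matrix.vecTail]

theorem iSup_eq_of_lt {a b : Fin 2} {θ : Fin 2 → ℝ} (h : θ a < θ b) : ⨆ j, θ j = θ b := by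
  have hab : a ≠ b := fun e => h.ne (congrArg θ e)
  refine le_antisymm (ciSup_le fun i => ?_) (le_ciSup (Set.finite_range θ).bddAbove b)
  rcases eq_or_eq_of_ne hab i with rfl | rfl
  · exact h.le
  · exact le_rfl

theorem gap_twoArms {a b : Fin 2} {θ : Fin 2 → ℝ} (h : θ a < θ b) (i : Fin 2) :
    gap twoArms θ i = θ b - θ i := by
  rw [gap, meanReward_twoArms, iSup_eq_of_lt h]

theorem isAdmissible_twoArms {a b : Fin 2} {θ : Fin 2 → ℝ} {L : ℝ} (h : θ a < θ b)
    (hL : ∀ i, |θ i| ≤ L) : IsAdmissible L twoArms θ := by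
  have hab : a ≠ b := fun e => h.ne (congrArg θ e)
  rw [IsAdmissible, meanReward_twoArms]
  exact ⟨⟨b, fun i hi => by rwa [(eq_or_eq_of_ne hab i).resolve_right hi]⟩, hL⟩

theorem IsAdmissible.exists_lt {θ : Fin 2 → ℝ} {L : ℝ} (h : IsAdmissible L twoArms θ) :
    ∃ a b, θ a < θ b := by
  rw [IsAdmissible, meanReward_twoArms] at h
  obtain ⟨⟨b, hb⟩, -⟩ := h
  obtain ⟨a, ha⟩ := exists_ne b
  exact ⟨a, b, hb a ha⟩

theorem designMatrix_twoArms (w : Fin 2 → ℝ) :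
    designMatrix twoArms w = Matrix.diagonal w := by
  ext i j
  fin_cases i <;> fin_cases j <;>
    simp [designMatrix, twoArms, Matrix.vecMulVec_apply, Matrix.sum_apply]

theorem quadForm_twoArms {a b : Fin 2} (hab : a ≠ b) {w : Fin 2 → ℝ} (hw : ∀ i, 0 < w i) :
    (twoArms a - twoArms b) ⬝ᵥ ((designMatrix twoArms w)⁻¹ *ᵥ (twoArms a - twoArms b)) =
      (w a)⁻¹ + (w b)⁻¹ := by
  have hinv : (designMatrix twoArms w)⁻¹ = Matrix.diagonal fun i => (w i)⁻¹ := by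
    refine Matrix.inv_eq_right_inv ?_
    rw [designMatrix_twoArms, Matrix.diagonal_mul_diagonal, ← Matrix.diagonal_one]
    congr 1
    funext i
    exact mul_inv_cancel₀ (hw i).ne'
  rw [hinv]
  fin_cases a <;> fin_cases b <;> first
    | exact absurd rfl hab
    | simp [twoArms, Matrix.mulVec_diagonal, dotProduct, add_comm]

/-- Pulls of the best arm are free, so its weight can be sent to infinity; the constraint `(w a)⁻¹ +
(w b)⁻¹ ≤ D ^ 2 / 2` then only asks for `w a` close to `2 / D ^ 2`. -/
theorem cStar_twoArms_le {a b : Fin 2} {θ : Fin 2 → ℝ} (h : θ a < θ b) :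
    cStar twoArms θ ≤ 2 / (θ b - θ a) := by
  have hab : a ≠ b := fun e => h.ne (congrArg θ e)
  have hD : 0 < θ b - θ a := sub_pos.2 h
  have hη : ∀ η : ℝ, 0 < η → cStar twoArms θ ≤ 2 / (θ b - θ a) * (1 + η) := by
    intro η hη
    set D := θ b - θ a with hDdef
    -- These weights make the constraint an equality, since `1 / (1 + η) + η / (1 + η) = 1`.
    set w : Fin 2 → ℝ := fun i => if i = a then 2 / D ^ 2 * (1 + η) else
      2 / D ^ 2 * (1 + η) / η with hw
    have hwa : w a = 2 / D ^ 2 * (1 + η) := by simp [hw]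
    have hwb : w b = 2 / D ^ 2 * (1 + η) / η := by simp [hw, hab.symm]
    have hpos : ∀ i, 0 < w i := by
      intro i
      rcases eq_or_eq_of_ne hab i with rfl | rfl
      · rw [hwa]; positivity
      · rw [hwb]; positivity
    refine csInf_le ⟨0, ?_⟩ ⟨w, ⟨fun i => (hpos i).le, ?_, ?_⟩, ?_⟩
    · rintro c ⟨w', hw', rfl⟩
      refine Finset.sum_nonneg fun i _ => mul_nonneg (hw'.1 i) ?_
      rw [gap_twoArms h]
      rcases eq_or_eq_of_ne hab i with rfl | rfl
      · exact hD.le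
      · rw [sub_self]
    · rw [designMatrix_twoArms]
      exact Matrix.PosDef.diagonal hpos
    · intro b' hb' i hi
      have hb : b' = b := by
        rcases eq_or_eq_of_ne hab b' with rfl | rfl
        · rw [gap_twoArms h] at hb'
          exact absurd hb' hD.ne'
        · rfl
      subst hb
      obtain rfl := (eq_or_eq_of_ne hab i).resolve_right hi
      rw [quadForm_twoArms hi hpos, gap_twoArms h, hwa, hwb, ← hDdef]
      refine le_of_eq ?_
      field_simp
    · rw [sum_eq_add_of_ne hab, gap_twoArms h, gap_twoArms h, sub_self, mul_zero, add_zero, hwa,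
        ← hDdef]
      field_simp
  have hlim : Tendsto (fun η : ℝ => 2 / (θ b - θ a) * (1 + η)) (𝓝[>] 0)
      (𝓝 (2 / (θ b - θ a) * (1 + 0))) :=
    (Continuous.tendsto (by fun_prop) 0).mono_left nhdsWithin_le_nhds
  rw [add_zero, mul_one] at hlim
  exact ge_of_tendsto hlim (eventually_nhdsWithin_of_forall fun η h => hη η h)

variable {Ω : Type*} [MeasurableSpace Ω] (P : Measure Ω)

namespace BatchedAlgorithm

variable {T : ℕ} (A : BatchedAlgorithm Ω (Fin 2) T)

theorem measurable_pullCount_cast (i : Fin 2) :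
    Measurable fun p : Ω × (ℕ → ℝ) => (A.pullCount p.1 p.2 T i : ℝ) :=
  measurable_from_top.comp (A.measurable_pullCount T i)

theorem integrable_pullCount [IsProbabilityMeasure P] (m : Fin 2 → ℝ) (i : Fin 2) :
    Integrable (fun p : Ω × (ℕ → ℝ) => (A.pullCount p.1 p.2 T i : ℝ)) (A.law P m) := by
  refine Integrable.of_bound (A.measurable_pullCount_cast i).aestronglyMeasurable (T : ℝ)
    (ae_of_all _ fun p => ?_)
  rw [Real.norm_of_nonneg (Nat.cast_nonneg _)]
  exact_mod_cast A.pullCount_le _ _ _ _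

theorem regret_twoArms {a b : Fin 2} {θ : Fin 2 → ℝ} (h : θ a < θ b) :
    regret P twoArms A θ =
      (θ b - θ a) * ∫ p, (A.pullCount p.1 p.2 T a : ℝ) ∂A.law P θ := by
  have hab : a ≠ b := fun e => h.ne (congrArg θ e)
  rw [regret, law, meanReward_twoArms, integral_map (A.measurable_prodMk_rewards θ).aemeasurable
    (A.measurable_pullCount_cast a).aestronglyMeasurable, ← integral_const_mul]
  refine integral_congr_ae (ae_of_all _ fun p => ?_)
  dsimp only
  rw [A.sum_pulledArm (gap twoArms θ), sum_eq_add_of_ne hab, gap_twoArms h, gap_twoArms h,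
    sub_self, mul_zero, add_zero, mul_comm]

theorem law_real_le_pullCount [IsProbabilityMeasure P] (m : Fin 2 → ℝ) (i : Fin 2) {c : ℝ}
    (hc : 0 < c) :
    (A.law P m).real {p | c ≤ A.pullCount p.1 p.2 T i} ≤
      (∫ p, (A.pullCount p.1 p.2 T i : ℝ) ∂A.law P m) / c := by
  rw [le_div_iff₀' hc]
  exact mul_meas_ge_le_integral_of_nonneg (ae_of_all _ fun p => Nat.cast_nonneg _)
    (A.integrable_pullCount P m i) c

theorem expectedBatches_twoArms (θ : Fin 2 → ℝ) :
    expectedBatches P twoArms A θ = ∫⁻ p, (A.numBatches p.1 p.2 : ℝ≥0∞) ∂A.law P θ := by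
  have hm : Measurable fun p : Ω × (ℕ → ℝ) => (A.numBatches p.1 p.2 : ℝ≥0∞) :=
    measurable_from_top.comp A.measurable_numBatches
  rw [expectedBatches, law, meanReward_twoArms, lintegral_map hm (A.measurable_prodMk_rewards θ)]

theorem divergence_eq_sum (m m' : Fin 2 → ℝ) (ω : Ω) (t : ℕ) (r : ℕ → ℝ) :
    A.divergence m m' ω t r = ∑ i, A.pullCount ω r t i * ((m i - m' i) ^ 2 / 2) :=
  A.sum_pulledArm (fun i => (m i - m' i) ^ 2 / 2) ω r t

end BatchedAlgorithm

end TwoArms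

/-! ### Consequences of asymptotic optimality -/

section Asymptotics

theorem tendsto_log_natCast : Tendsto (fun T : ℕ => Real.log T) atTop atTop :=
  Real.tendsto_log_atTop.comp tendsto_natCast_atTop_atTop

theorem tendsto_log_div_natCast (C : ℝ) :
    Tendsto (fun T : ℕ => C * Real.log T / T) atTop (𝓝 0) := by
  have h := (Real.isLittleO_log_id_atTop.tendsto_div_nhds_zero.comp
    tendsto_natCast_atTop_atTop).const_mul C
  rw [mul_zero] at h
  refine h.congr fun T => ?_
  simp [mul_div_assoc]

theorem eventually_mul_log_le (k : ℝ) : ∀ᶠ T : ℕ in atTop, k * Real.log T ≤ T / 2 := by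
  filter_upwards [(tendsto_log_div_natCast k).eventually_lt_const (u := 1 / 2) (by norm_num),
    eventually_gt_atTop 0] with T h hT
  have hT' : (0 : ℝ) < T := by exact_mod_cast hT
  rw [div_lt_iff₀ hT'] at h
  linarith

variable {Ω : Type*} [MeasurableSpace Ω] {P : Measure Ω}
  {A : (T : ℕ) → BatchedAlgorithm Ω (Fin 2) T}

/-- An event whose divergence is at most `κ log T` with `κ < 1`, and whose probability is
`O(log T / T)` for the mean rewards `m'`, has a vanishing probability for the mean rewards `m`. -/
theorem tendsto_law_real_zero [IsProbabilityMeasure P]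
    {m m' : Fin 2 → ℝ} {G : ℕ → Set (Ω × (ℕ → ℝ))}
    (hG : ∀ T, MeasurableSet (G T)) (τ : (T : ℕ) → Ω → ℕ)
    (hτ : ∀ᶠ T in atTop, ∀ ω, τ T ω ≤ T)
    (hdet : ∀ᶠ T in atTop, ∀ ω r r', (∀ i < τ T ω, r i = r' i) → (ω, r) ∈ G T → (ω, r') ∈ G T)
    {κ : ℝ} (hκ0 : 0 ≤ κ) (hκ : κ < 1)
    (hdiv : ∀ᶠ T in atTop, ∀ ω r, (ω, r) ∈ G T →
      (A T).divergence m m' ω (τ T ω) r ≤ κ * Real.log T)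
    {C : ℝ} (hC : ∀ᶠ T : ℕ in atTop, ((A T).law P m').real (G T) ≤ C * Real.log T / T) :
    Tendsto (fun T => ((A T).law P m).real (G T)) atTop (𝓝 0) := by
  -- The choice gives `q * κ < z < 1`: then `T ^ z` times `log T / T` vanishes, and so does the
  -- moment term `T ^ (-(q - 1) * (z - q * κ))`.
  set z : ℝ := (1 + κ) / 2 with hz
  set q : ℝ := 1 + (1 - κ) / 4 with hq
  have hq1 : 1 < q := by linarith
  have hz1 : 0 < 1 - z := by linarith
  have hqz : 0 < (q - 1) * (z - q * κ) := mul_pos (by linarith) (by nlinarith)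
  have hlim : Tendsto (fun T : ℕ => C * (Real.log T ^ (1 : ℝ) * Real.exp (-(1 - z) * Real.log T)) +
      Real.exp (-(((q - 1) * (z - q * κ)) * Real.log T))) atTop (𝓝 (C * 0 + 0)) := by
    refine Tendsto.add (Tendsto.const_mul C ?_) ?_
    · exact (tendsto_rpow_mul_exp_neg_mul_atTop_nhds_zero 1 (1 - z) hz1).comp tendsto_log_natCast
    · exact Real.tendsto_exp_neg_atTop_nhds_zero.comp (tendsto_log_natCast.const_mul_atTop hqz)
  rw [mul_zero, add_zero] at hlim
  refine squeeze_zero' (Eventually.of_forall fun T => measureReal_nonneg) ?_ hlim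
  filter_upwards [hτ, hdet, hdiv, hC, eventually_gt_atTop 0] with T h1 h2 h3 h4 hT
  have hT' : (0 : ℝ) < T := by exact_mod_cast hT
  refine ((A T).law_real_le P m m' (hG T) (τ T) h1 h2 (z := z * Real.log T) hq1.le h3).trans ?_
  refine add_le_add ?_ (le_of_eq ?_)
  · refine (mul_le_mul_of_nonneg_left h4 (Real.exp_pos _).le).trans (le_of_eq ?_)
    have e : Real.exp (-(1 - z) * Real.log T) = Real.exp (z * Real.log T) / T := by
      rw [show -(1 - z) * Real.log T = z * Real.log T - Real.log T by ring, Real.exp_sub,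
        Real.exp_log hT']
    rw [Real.rpow_one, e]
    ring
  · congr 1
    ring

variable {L : ℝ}

/-- The regret is the gap times the expected pulls of `a`. An upper bound on `cStar` is enough, as
lower bounds on the pulls come from the change of measure. -/
theorem AsymptoticallyOptimal.tendsto_pullCount (hA : AsymptoticallyOptimal L P twoArms A)
    {a b : Fin 2} {θ : Fin 2 → ℝ} (h : θ a < θ b) (hL : ∀ i, |θ i| ≤ L) :
    ∃ c ≤ 2 / (θ b - θ a) ^ 2,
      Tendsto (fun T : ℕ => (∫ p, ((A T).pullCount p.1 p.2 T a : ℝ) ∂(A T).law P θ) / Real.log T)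
        atTop (𝓝 c) := by
  have hD : 0 < θ b - θ a := sub_pos.2 h
  refine ⟨cStar twoArms θ / (θ b - θ a), ?_, ?_⟩
  · rw [div_le_iff₀ hD]
    refine (cStar_twoArms_le h).trans (le_of_eq ?_)
    field_simp
  · refine ((hA θ (isAdmissible_twoArms h hL)).div_const (θ b - θ a)).congr fun T => ?_
    rw [(A T).regret_twoArms P h]
    field_simp

/-- Linearly many pulls of the suboptimal arm are unlikely. -/
theorem AsymptoticallyOptimal.exists_law_real_le [IsProbabilityMeasure P]
    (hA : AsymptoticallyOptimal L P twoArms A)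
    {a b : Fin 2} {θ : Fin 2 → ℝ} (h : θ a < θ b) (hL : ∀ i, |θ i| ≤ L) :
    ∃ C : ℝ, ∀ᶠ T : ℕ in atTop,
      ((A T).law P θ).real {p | (T : ℝ) / 2 ≤ (A T).pullCount p.1 p.2 T a} ≤
        C * Real.log T / T := by
  obtain ⟨c, -, hc⟩ := hA.tendsto_pullCount h hL
  -- Markov's inequality at `T / 2`, with expected pulls eventually below `(c + 1) * log T`.
  refine ⟨2 * (c + 1), ?_⟩
  filter_upwards [hc.eventually_lt_const (lt_add_one c),
    tendsto_log_natCast.eventually_gt_atTop 0, eventually_gt_atTop 0] with T h1 h2 hT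
  have hT' : (0 : ℝ) < T := by exact_mod_cast hT
  refine ((A T).law_real_le_pullCount P θ a (half_pos hT')).trans ?_
  rw [div_lt_iff₀ h2] at h1
  rw [div_le_div_iff₀ (half_pos hT') hT']
  nlinarith

/-- The Lai–Robbins lower bound, in probability. -/
theorem AsymptoticallyOptimal.tendsto_pullCount_le [IsProbabilityMeasure P]
    (hA : AsymptoticallyOptimal L P twoArms A)
    {a b : Fin 2} {θ θ' : Fin 2 → ℝ} (hab : a ≠ b) (hb : θ' b = θ b)
    (h' : θ' b < θ' a) (hL' : ∀ i, |θ' i| ≤ L) {k : ℝ} (hk : 0 ≤ k)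
    (hk1 : k * ((θ a - θ' a) ^ 2 / 2) < 1) :
    Tendsto (fun T : ℕ => ((A T).law P θ).real
      {p | ((A T).pullCount p.1 p.2 T a : ℝ) ≤ k * Real.log T}) atTop (𝓝 0) := by
  obtain ⟨C, hC⟩ := hA.exists_law_real_le h' hL'
  refine tendsto_law_real_zero (m' := θ')
    (fun T => measurableSet_le ((A T).measurable_pullCount_cast a) measurable_const)
    (fun T _ => T) (Eventually.of_forall fun T ω => le_rfl)
    (Eventually.of_forall fun T ω r r' hr hmem => ?_) (by positivity) hk1
    (Eventually.of_forall fun T ω r hmem => ?_) (C := C) ?_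
  · have e := (A T).pullCount_congr (fun s hs =>
      (A T).pulledArm_congr (ω := ω) fun i hi => hr i (hi.trans hs)) a
    rw [Set.mem_ofPred_eq] at hmem ⊢
    rwa [← e]
  · rw [(A T).divergence_eq_sum, sum_eq_add_of_ne hab, hb, sub_self]
    rw [Set.mem_ofPred_eq] at hmem
    have := mul_le_mul_of_nonneg_right hmem (by positivity : 0 ≤ (θ a - θ' a) ^ 2 / 2)
    linarith
  -- Few pulls of `a` leave at least `T / 2` pulls for `b`, which is suboptimal under `θ'`.
  · filter_upwards [hC, eventually_mul_log_le k] with T h1 h2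
    refine (measureReal_mono fun p hp => ?_).trans h1
    rw [Set.mem_ofPred_eq] at hp ⊢
    have := (A T).sum_pullCount p.1 p.2 T
    rw [sum_eq_add_of_ne hab] at this
    linarith

/-- The first batch cannot pull an arm more often than is optimal on some instance. -/
theorem AsymptoticallyOptimal.tendsto_le_firstCount [IsProbabilityMeasure P]
    (hA : AsymptoticallyOptimal L P twoArms A)
    {a b : Fin 2} {θ : Fin 2 → ℝ} (h : θ a < θ b) (hL : ∀ i, |θ i| ≤ L) (hbL : θ b < L)
    {μ : ℝ} (hμ : 2 / (θ b - θ a) ^ 2 < μ) :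
    Tendsto (fun T : ℕ => P.real {ω | μ * Real.log T ≤ (A T).firstCount ω a}) atTop (𝓝 0) := by
  have hab : a ≠ b := fun e => h.ne (congrArg θ e)
  have hD : 0 < θ b - θ a := sub_pos.2 h
  set v : ℝ := 2 / (θ b - θ a) ^ 2 with hv
  have hv0 : 0 < v := by positivity
  obtain ⟨c, hcv, hc⟩ := hA.tendsto_pullCount h hL
  refine tendsto_order.2 ⟨fun x hx => Eventually.of_forall fun T =>
    hx.trans_le measureReal_nonneg, fun ε hε => ?_⟩
  -- The final bound on the probability is `(v - k) / (μ - k)`, which is small for `k` close to `v`.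
  obtain ⟨k, hkε, hk0, hkv⟩ : ∃ k, (v - k) / (μ - k) < ε ∧ 0 < k ∧ k < v := by
    have h1 : Tendsto (fun k : ℝ => (v - k) / (μ - k)) (𝓝[<] v) (𝓝 ((v - v) / (μ - v))) :=
      (ContinuousAt.tendsto (ContinuousAt.div (by fun_prop) (by fun_prop)
        (sub_pos.2 hμ).ne')).mono_left nhdsWithin_le_nhds
    rw [sub_self, zero_div] at h1
    have h2 : ∀ᶠ k in 𝓝[<] v, 0 < k := nhdsWithin_le_nhds (lt_mem_nhds hv0)
    exact ((h1.eventually_lt_const hε).and (h2.and self_mem_nhdsWithin)).exists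
  obtain ⟨ρ, hkρ, hρL, hρ0⟩ :
      ∃ ρ, k * ((θ b - θ a + ρ) ^ 2 / 2) < 1 ∧ ρ < L - θ b ∧ 0 < ρ := by
    have h1 : Tendsto (fun ρ : ℝ => k * ((θ b - θ a + ρ) ^ 2 / 2)) (𝓝[>] 0)
        (𝓝 (k * ((θ b - θ a + 0) ^ 2 / 2))) :=
      (Continuous.tendsto (by fun_prop) 0).mono_left nhdsWithin_le_nhds
    have hk1 : k * ((θ b - θ a + 0) ^ 2 / 2) < 1 := by
      rw [hv, lt_div_iff₀ (by positivity)] at hkv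
      rw [add_zero]
      linarith
    have h2 : ∀ᶠ ρ in 𝓝[>] (0 : ℝ), ρ < L - θ b :=
      nhdsWithin_le_nhds (gt_mem_nhds (sub_pos.2 hbL))
    exact ((h1.eventually_lt_const hk1).and (h2.and self_mem_nhdsWithin)).exists
  -- The alternative raises arm `a` just above arm `b`; the room for this is `θ b < L`.
  have hg := hA.tendsto_pullCount_le (θ := θ) (θ' := Function.update θ a (θ b + ρ)) hab
    (by simp [hab.symm]) (by simpa [hab.symm] using hρ0) (fun i => by
      rcases eq_or_eq_of_ne hab i with rfl | rfl
      · rw [Function.update_self]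
        exact abs_le.2 ⟨by linarith [(abs_le.1 (hL b)).1], by linarith⟩
      · rw [Function.update_of_ne hab.symm]
        exact hL i) hk0.le
    (by
      rw [Function.update_self]
      convert hkρ using 3
      ring)
  have hμk : 0 < μ - k := by linarith
  have hlim := ((hc.sub_const k).add (hg.const_mul k)).div_const (μ - k)
  have hlt : (c - k + k * 0) / (μ - k) < ε := by
    refine lt_of_le_of_lt ?_ hkε
    gcongr
    linarith
  filter_upwards [hlim.eventually_lt_const hlt, tendsto_log_natCast.eventually_gt_atTop 0,
    eventually_gt_atTop 0] with T h1 hlog hT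
  refine lt_of_le_of_lt ?_ h1
  set ℓ := Real.log T
  set S : Set (Ω × (ℕ → ℝ)) := {p | μ * ℓ ≤ (A T).firstCount p.1 a} with hSdef
  set G : Set (Ω × (ℕ → ℝ)) := {p | ((A T).pullCount p.1 p.2 T a : ℝ) ≤ k * ℓ} with hGdef
  have hS0 : MeasurableSet {ω | μ * ℓ ≤ (A T).firstCount ω a} :=
    measurableSet_le measurable_const (measurable_from_top.comp ((A T).measurable_firstCount a))
  have hS : MeasurableSet S := measurable_fst hS0
  have hG : MeasurableSet G := measurableSet_le ((A T).measurable_pullCount_cast a) measurable_const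
  have hPS : P.real {ω | μ * ℓ ≤ (A T).firstCount ω a} = ((A T).law P θ).real S := by
    rw [Measure.real, Measure.real, ← (A T).law_preimage_fst P θ hS0]
    rfl
  have hint_one : ∀ {B : Set (Ω × (ℕ → ℝ))} (x : ℝ), MeasurableSet B →
      Integrable (fun p => x * B.indicator 1 p) ((A T).law P θ) := fun x hB =>
    ((integrable_const (1 : ℝ)).indicator hB).const_mul x
  -- Off `G` there are at least `k * ℓ` pulls of `a`, and on `S` at least `μ * ℓ`, already in the
  -- first batch. The term with `G` pays for the exceptional event.
  have hint : ∫ p, (k * ℓ + ((μ - k) * ℓ * S.indicator 1 p - k * ℓ * G.indicator 1 p))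
      ∂(A T).law P θ ≤ ∫ p, ((A T).pullCount p.1 p.2 T a : ℝ) ∂(A T).law P θ := by
    refine integral_mono ?_ ((A T).integrable_pullCount P θ a) fun p => ?_
    · exact (integrable_const _).add ((hint_one _ hS).sub (hint_one _ hG))
    · have hN : (0 : ℝ) ≤ (A T).pullCount p.1 p.2 T a := Nat.cast_nonneg _
      have hF : ((A T).firstCount p.1 a : ℝ) ≤ (A T).pullCount p.1 p.2 T a := by
        exact_mod_cast (A T).firstCount_le_pullCount p.1 p.2 hT a
      have hkl : 0 ≤ k * ℓ := by positivity
      by_cases hpS : p ∈ S <;> by_cases hpG : p ∈ G <;>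
        simp only [hpS, hpG, Set.indicator_of_mem, Set.indicator_of_notMem, not_false_eq_true,
          Pi.one_apply, mul_one, mul_zero] <;>
        simp only [hSdef, hGdef, Set.mem_ofPred_eq, not_le] at hpS hpG <;> linarith
  rw [integral_add (integrable_const _) (by exact (hint_one _ hS).sub (hint_one _ hG)),
    integral_sub (hint_one _ hS) (hint_one _ hG), integral_const, probReal_univ, one_smul,
    integral_const_mul, integral_const_mul, integral_indicator_one hS,
    integral_indicator_one hG] at hint
  rw [hPS, le_div_iff₀ hμk]
  have h3 : k + (μ - k) * ((A T).law P θ).real S - k * ((A T).law P θ).real G ≤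
      (∫ p, ((A T).pullCount p.1 p.2 T a : ℝ) ∂(A T).law P θ) / ℓ := by
    rw [le_div_iff₀ hlog]
    linarith
  linarith

/-- On every admissible instance, the probability of at most two batches vanishes. -/
theorem AsymptoticallyOptimal.tendsto_numBatches_le_two [IsProbabilityMeasure P]
    (hA : AsymptoticallyOptimal L P twoArms A) (hL0 : 0 < L) {a b : Fin 2} {θ : Fin 2 → ℝ}
    (h : θ a < θ b) (hL : ∀ i, |θ i| ≤ L) :
    Tendsto (fun T : ℕ => ((A T).law P θ).real {p | (A T).numBatches p.1 p.2 ≤ 2})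
      atTop (𝓝 0) := by
  have hab : a ≠ b := fun e => h.ne (congrArg θ e)
  -- The means `±9/10 * L` below have gap `9/5 * L`, and `2 / (9/5) ^ 2 < 7/10`. They stay away from
  -- `L`, as `tendsto_le_firstCount` requires.
  set μ : ℝ := 7 / 10 / L ^ 2 with hμ
  have hfirst : ∀ i j : Fin 2, i ≠ j → Tendsto
      (fun T : ℕ => P.real {ω | μ * Real.log T ≤ (A T).firstCount ω i}) atTop (𝓝 0) := by
    intro i j hij
    set m : Fin 2 → ℝ := fun k => if k = i then -(9 / 10 * L) else 9 / 10 * L with hm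
    have hmi : m i = -(9 / 10 * L) := by simp [hm]
    have hmj : m j = 9 / 10 * L := by simp [hm, hij.symm]
    refine hA.tendsto_le_firstCount (θ := m) (a := i) (b := j) (by linarith) (fun k => ?_)
      (by linarith) ?_
    · rcases eq_or_eq_of_ne hij k with rfl | rfl
      · rw [hmi, abs_le]
        constructor <;> linarith
      · rw [hmj, abs_le]
        constructor <;> linarith
    · rw [hmi, hmj, hμ, div_lt_div_iff₀ (by nlinarith) (by positivity)]
      nlinarith [sq_pos_of_pos hL0]
  set D := θ b - θ a with hDdef
  have hD : 0 < D := sub_pos.2 h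
  -- Moving both arms by a little over half the gap reverses their order and keeps the means between
  -- `θ a` and `θ b`. Moving one arm by the whole gap could cost `μ * D ^ 2 / 2 * log T`, up to `7/5
  -- * log T`, which is too much.
  set θ' : Fin 2 → ℝ := fun k => if k = a then θ a + 11 / 20 * D else θ b - 11 / 20 * D with hθ'
  have hθa : θ' a = θ a + 11 / 20 * D := by simp [hθ']
  have hθb : θ' b = θ b - 11 / 20 * D := by simp [hθ', hab.symm]
  have hLa := abs_le.1 (hL a)
  have hLb := abs_le.1 (hL b)
  have h' : θ' b < θ' a := by linarith
  have hL' : ∀ i, |θ' i| ≤ L := by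
    intro k
    rcases eq_or_eq_of_ne hab k with rfl | rfl
    · rw [hθa, abs_le]
      constructor <;> linarith
    · rw [hθb, abs_le]
      constructor <;> linarith
  set G : (T : ℕ) → Set (Ω × (ℕ → ℝ)) := fun T => {p |
    (T ≤ (A T).firstSize p.1 + (A T).size ((A T).firstSize p.1) p.1 (fun i => p.2 i) ∧
      (T : ℝ) / 2 ≤ (A T).pullCount p.1 p.2 T b) ∧
    (((A T).firstCount p.1 a : ℝ) ≤ μ * Real.log T ∧
      ((A T).firstCount p.1 b : ℝ) ≤ μ * Real.log T)} with hGdef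
  have hGmeas : ∀ T, MeasurableSet (G T) := by
    intro T
    have hf : ∀ i, MeasurableSet
        {p : Ω × (ℕ → ℝ) | ((A T).firstCount p.1 i : ℝ) ≤ μ * Real.log T} := fun i =>
      measurableSet_le (measurable_from_top.comp
        (((A T).measurable_firstCount i).comp measurable_fst)) measurable_const
    have hn : Measurable fun p : Ω × (ℕ → ℝ) => (A T).firstSize p.1 :=
      (A T).measurable_firstSize.comp measurable_fst
    exact ((measurableSet_le measurable_const
      (hn.add ((A T).measurable_size_comp hn measurable_fst measurable_snd))).inter
        (measurableSet_le measurable_const ((A T).measurable_pullCount_cast b))).inter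
      ((hf a).inter (hf b))
  have hGlim : Tendsto (fun T => ((A T).law P θ).real (G T)) atTop (𝓝 0) := by
    obtain ⟨C, hC⟩ := hA.exists_law_real_le h' hL'
    -- The event is decided by the first batch, whose divergence is at most `2 * (28/10) * (121/800)
    -- * log T = 0.847 * log T`.
    refine tendsto_law_real_zero (m' := θ') hGmeas (fun T => (A T).firstSize)
      ?_ ?_ (κ := 9 / 10) (by norm_num) (by norm_num) ?_ (C := C) ?_
    · filter_upwards [eventually_gt_atTop 0] with T hT ω
      exact (A T).firstSize_le ω hT
    · filter_upwards [eventually_gt_atTop 0] with T hT ω r r' hr hmem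
      obtain ⟨⟨h1, h2⟩, h3⟩ := hmem
      have e := (A T).pullCount_congr (fun s hs =>
        (A T).pulledArm_congr_of_two_batches hT h1 hr hs) b
      refine ⟨⟨?_, ?_⟩, h3⟩
      · dsimp only at h1 ⊢
        rwa [← (A T).size_congr hr]
      · dsimp only at h2 ⊢
        rwa [← e]
    · filter_upwards [tendsto_log_natCast.eventually_gt_atTop 0] with T hlog ω r hmem
      obtain ⟨-, h3, h4⟩ := hmem
      dsimp only at h3 h4
      rw [(A T).divergence_eq_sum, sum_eq_add_of_ne hab, (A T).pullCount_firstSize,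
        (A T).pullCount_firstSize, hθa, hθb]
      have hDL : D ^ 2 ≤ 4 * L ^ 2 := by nlinarith
      have hμD : μ * D ^ 2 ≤ 28 / 10 := by
        rw [hμ, div_mul_eq_mul_div, div_le_iff₀ (by positivity)]
        linarith
      have e1 : (θ a - (θ a + 11 / 20 * D)) ^ 2 / 2 = 121 / 800 * D ^ 2 := by ring
      have e2 : (θ b - (θ b - 11 / 20 * D)) ^ 2 / 2 = 121 / 800 * D ^ 2 := by ring
      rw [e1, e2]
      have h5 := mul_le_mul_of_nonneg_right h3 (by positivity : 0 ≤ 121 / 800 * D ^ 2)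
      have h6 := mul_le_mul_of_nonneg_right h4 (by positivity : 0 ≤ 121 / 800 * D ^ 2)
      have h7 := mul_le_mul_of_nonneg_right hμD hlog.le
      linarith
    · filter_upwards [hC] with T h1
      exact (measureReal_mono fun p hp => hp.1.2).trans h1
  obtain ⟨C, hC⟩ := hA.exists_law_real_le h hL
  have hsum := (((hfirst a b hab).add (hfirst b a hab.symm)).add
    (tendsto_log_div_natCast C)).add hGlim
  rw [add_zero, add_zero, add_zero] at hsum
  refine squeeze_zero' (Eventually.of_forall fun T => measureReal_nonneg) ?_ hsum
  filter_upwards [hC, eventually_gt_atTop 0] with T h1 hT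
  have hS0 : ∀ i, MeasurableSet {ω | μ * Real.log T ≤ (A T).firstCount ω i} := fun i =>
    measurableSet_le measurable_const (measurable_from_top.comp ((A T).measurable_firstCount i))
  have hPS : ∀ i, P.real {ω | μ * Real.log T ≤ (A T).firstCount ω i} =
      ((A T).law P θ).real (Prod.fst ⁻¹' {ω | μ * Real.log T ≤ (A T).firstCount ω i}) := by
    intro i
    rw [Measure.real, Measure.real, ← (A T).law_preimage_fst P θ (hS0 i)]
  rw [hPS, hPS]
  -- Two batches require a large first batch (in `a` or in `b`), or at least `T / 2` pulls of the
  -- suboptimal arm, or the event `G T`.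
  refine le_trans ?_ (add_le_add_left (add_le_add_right h1 _) _)
  refine le_trans (measureReal_mono ?_) ((measureReal_union_le _ _).trans (add_le_add_left
    ((measureReal_union_le _ _).trans (add_le_add_left (measureReal_union_le _ _) _)) _))
  intro p hp
  rw [Set.mem_ofPred_eq] at hp
  by_cases ha : μ * Real.log T ≤ (A T).firstCount p.1 a
  · exact Or.inl (Or.inl (Or.inl ha))
  by_cases hb : μ * Real.log T ≤ (A T).firstCount p.1 b
  · exact Or.inl (Or.inl (Or.inr hb))
  by_cases hN : (T : ℝ) / 2 ≤ (A T).pullCount p.1 p.2 T a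
  · exact Or.inl (Or.inr hN)
  refine Or.inr ⟨⟨?_, ?_⟩, (not_le.1 ha).le, (not_le.1 hb).le⟩
  -- If the first batch fills the horizon, the inequality holds whatever the default size after it.
  · rcases ((A T).firstSize_le p.1 hT).eq_or_lt with h2 | h2
    · omega
    · exact (A T).le_of_numBatches_le_two hT hp h2
  · have hs := (A T).sum_pullCount p.1 p.2 T
    rw [sum_eq_add_of_ne hab] at hs
    linarith

/-- Markov's inequality at level `3`: the expectation is at least three times the probability of
more than two batches. -/
theorem AsymptoticallyOptimal.three_le_liminf [IsProbabilityMeasure P]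
    (hA : AsymptoticallyOptimal L P twoArms A)
    (hL0 : 0 < L) {a b : Fin 2} {θ : Fin 2 → ℝ} (h : θ a < θ b) (hL : ∀ i, |θ i| ≤ L) :
    3 ≤ liminf (fun T : ℕ => expectedBatches P twoArms (A T) θ) atTop := by
  have h0 : Tendsto (fun T : ℕ => (A T).law P θ {p | (A T).numBatches p.1 p.2 ≤ 2})
      atTop (𝓝 0) := by
    rw [← ENNReal.tendsto_toReal_iff (fun T => measure_ne_top _ _) ENNReal.zero_ne_top]
    exact hA.tendsto_numBatches_le_two hL0 h hL
  have h1 : Tendsto (fun T : ℕ =>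
      3 * (1 - (A T).law P θ {p | (A T).numBatches p.1 p.2 ≤ 2})) atTop (𝓝 (3 * (1 - 0))) :=
    ENNReal.Tendsto.const_mul (ENNReal.Tendsto.sub tendsto_const_nhds h0 (Or.inl (by simp)))
      (Or.inr (by simp))
  rw [tsub_zero, mul_one] at h1
  rw [← h1.liminf_eq]
  refine liminf_le_liminf (Eventually.of_forall fun T => ?_)
  have hm : Measurable fun p : Ω × (ℕ → ℝ) => ((A T).numBatches p.1 p.2 : ℝ≥0∞) :=
    measurable_from_top.comp (A T).measurable_numBatches
  have hset : MeasurableSet {p : Ω × (ℕ → ℝ) | (A T).numBatches p.1 p.2 ≤ 2} :=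
    measurableSet_le (A T).measurable_numBatches measurable_const
  rw [(A T).expectedBatches_twoArms P θ, ← prob_compl_eq_one_sub hset]
  refine le_trans ?_ (mul_meas_ge_le_lintegral hm 3)
  gcongr
  intro p hp
  rw [Set.mem_compl_iff, Set.mem_ofPred_eq, not_le] at hp
  rw [Set.mem_ofPred_eq]
  exact_mod_cast hp

end Asymptotics

end

theorem theorem1 {Ω : Type*} [MeasurableSpace Ω] (P : Measure Ω) [IsProbabilityMeasure P]
    (L : ℝ) (hL : 0 < L) (A : (T : ℕ) → BatchedAlgorithm Ω (Fin 2) T)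
    (hA : AsymptoticallyOptimal L P twoArms A) :
    (∃ θ : Fin 2 → ℝ, IsAdmissible L twoArms θ) ∧
      ∀ θ : Fin 2 → ℝ, IsAdmissible L twoArms θ →
        3 ≤ liminf (fun T : ℕ => expectedBatches P twoArms (A T) θ) atTop := by
  refine ⟨⟨![L, 0], isAdmissible_twoArms (a := 1) (b := 0) hL fun i => ?_⟩, fun θ hθ => ?_⟩
  · fin_cases i
    · exact (abs_of_pos hL).le
    · simpa using hL.le
  · obtain ⟨a, b, h⟩ := hθ.exists_lt
    have hb := hθ.2
    rw [meanReward_twoArms] at hb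
    exact hA.three_le_liminf hL h hb
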